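/- Let $\Theta$ and $U$ be compact metric spaces, $U\neq\emptyset$, and let $\mathcal H$ be a complex Hilbert space. Let $\rho$ assign to every $\theta\in\Theta$ a density operator $\rho(\theta)$ on $\mathcal H$ (positive, trace class, $\operatorname{Tr}\rho(\theta)=1$). Assume that $\rho$ is injective and regular, i.e. for every compact $K\subseteq\Theta$ $$\inf\bigl\{\|X\|_1 : X \text{ trace class},\ -X\le\rho(\theta)-\rho(\eta)\le X\ \text{ for all }\theta,\eta\in K \text{ with } d(\theta,\eta)<\delta\bigr\}\longrightarrow 0\qquad(\delta\to0).$$ Let $w:\Theta\times U\to\mathbb R\cup\{+\infty\}$ be a loss function, i.e. lower semicontinuous and bounded from below. A POVM is a map $M$ from the Borel sets of $U$ to the positive bounded operators on $\mathcal H$ that is countably additive in the weak operator topology and satisfies $M(U)=I$. The risk of $M$ is $R_M(\theta)=R^w_M(\theta)=\int_U w(\theta,u)\,\operatorname{Tr}\rho(\theta)M(du)$, and $M$ is called minimax if it minimizes $\sup_{\theta\in\Theta}R_M(\theta)$ among all POVMs. Then a minimax POVM exists. More precisely, let $$V=\sup_{\pi}\inf_{M}\int_\Theta R_M(\theta)\,\pi(d\theta),$$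 where $\pi$ runs over the Borel probability measures on $\Theta$ and $M$ over the POVMs. Then there is a POVM $M_*$ such that, for every continuous $v:\Theta\times U\to\mathbb R$ with $v\le w$ and every $\theta\in\Theta$, $$R^v_{M_*}(\theta)=\int_U v(\theta,u)\,\operatorname{Tr}\rho(\theta)M_*(du)\le V,$$ and every POVM $M_*$ with this property is minimax. -/

import Mathlib

open Filter Topology MeasureTheory
open scoped ENNReal

namespace QuantumDecision

noncomputable section

/-! ### Trace-class operators on a complex Hilbert space -/

section TraceClass

variable (H : Type*) [NormedAddCommGroup H] [InnerProductSpace ℂ H] [CompleteSpace H]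

/-- Index set of a fixed orthonormal (Hilbert) basis of `H`. -/
def basisIndex : Set H := (exists_hilbertBasis ℂ H).choose

/-- A fixed orthonormal (Hilbert) basis of `H`. -/
def refBasis : HilbertBasis (basisIndex H) ℂ H := (exists_hilbertBasis ℂ H).choose_spec.choose

variable {H}

/-- The trace norm `‖X‖₁ = Tr |X|`, with value `∞` when `X` is not of trace class.
Here `|X| = √(X* X)`. -/
def traceNorm (X : H →L[ℂ] H) : ℝ≥0∞ :=
  ∑' i, ENNReal.ofReal (inner ℂ (refBasis H i) (CFC.abs X (refBasis H i))).re

/-- `X` is of trace class. -/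
def IsTraceClass (X : H →L[ℂ] H) : Prop := traceNorm X < ∞

/-- The trace `Tr X` of a trace-class operator `X`. -/
def trace (X : H →L[ℂ] H) : ℂ := ∑' i, inner ℂ (refBasis H i) (X (refBasis H i))

variable (H) in
/-- A density operator: a positive trace-class operator with trace one. -/
@[ext]
structure DensityOperator where
  op : H →L[ℂ] H
  isPositive : op.IsPositive
  isTraceClass : IsTraceClass op
  trace_eq_one : trace op = 1

end TraceClass

/-! ### Regular operator-valued functions -/

section Regular

variable {H : Type*} [NormedAddCommGroup H] [InnerProductSpace ℂ H] [CompleteSpace H]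
variable {Θ : Type*} [MetricSpace Θ]

/-- `ω_T(K_δ) = inf { ‖X‖₁ : -X ≤ T(θ) - T(η) ≤ X for all θ, η ∈ K with d(θ, η) < δ }`,
where `X` runs over the trace-class operators and `≤` is the Loewner order. -/
def oscillation (T : Θ → H →L[ℂ] H) (K : Set Θ) (δ : ℝ) : ℝ≥0∞ :=
  sInf (traceNorm '' {X : H →L[ℂ] H | IsTraceClass X ∧
    ∀ θ ∈ K, ∀ η ∈ K, dist θ η < δ → -X ≤ T θ - T η ∧ T θ - T η ≤ X})

/-- `T` is regular: `ω_T(K_δ) → 0` as `δ → 0`, for every compact set `K`. -/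
def IsRegular (T : Θ → H →L[ℂ] H) : Prop :=
  ∀ K : Set Θ, IsCompact K → Tendsto (oscillation T K) (𝓝[>] 0) (𝓝 0)

end Regular

/-! ### Positive operator-valued measures -/

/-- A POVM on the Borel sets of `U` (countable additivity in the weak operator topology);
on sets that are not measurable it has, by convention, the value `0`. -/
structure POVM (U : Type*) [MeasurableSpace U]
    (H : Type*) [NormedAddCommGroup H] [InnerProductSpace ℂ H] [CompleteSpace H] where
  op : Set U → H →L[ℂ] H
  isPositive : ∀ B, MeasurableSet B → (op B).IsPositive
  hasSum_iUnion : ∀ B : ℕ → Set U, (∀ j, MeasurableSet (B j)) → Pairwise (fun i j => Disjoint (B i) (B j)) →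
    ∀ x y : H, HasSum (fun j => inner ℂ x (op (B j) y)) (inner ℂ x (op (⋃ j, B j) y))
  op_univ : op Set.univ = 1
  op_of_not_measurableSet : ∀ B, ¬ MeasurableSet B → op B = 0

section Born

variable {H : Type*} [NormedAddCommGroup H] [InnerProductSpace ℂ H] [CompleteSpace H]
variable {U : Type*} [MeasurableSpace U]

theorem DensityOperator.nonneg (ρ : DensityOperator H) : 0 ≤ ρ.op :=
  (ContinuousLinearMap.nonneg_iff_isPositive _).2 ρ.isPositive

theorem DensityOperator.sqrt_symm (ρ : DensityOperator H) (x y : H) :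
    inner ℂ (CFC.sqrt ρ.op x) y = inner ℂ x (CFC.sqrt ρ.op y) := by
  have h : IsSelfAdjoint (CFC.sqrt ρ.op) := (CFC.sqrt_nonneg ρ.op).isSelfAdjoint
  exact h.isSymmetric x y

theorem DensityOperator.sqrt_sqrt (ρ : DensityOperator H) (x : H) :
    CFC.sqrt ρ.op (CFC.sqrt ρ.op x) = ρ.op x := by
  have h := CFC.sqrt_mul_sqrt_self ρ.op ρ.nonneg
  exact congrArg (fun T : H →L[ℂ] H => T x) h

theorem DensityOperator.inner_op (ρ : DensityOperator H) (x : H) :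
    (inner ℂ x (ρ.op x)).re = ‖CFC.sqrt ρ.op x‖ ^ 2 := by
  rw [← ρ.sqrt_sqrt, ← ρ.sqrt_symm]
  exact inner_self_eq_norm_sq (𝕜 := ℂ) _

theorem DensityOperator.summable_sq (ρ : DensityOperator H) :
    Summable fun j => ‖CFC.sqrt ρ.op (refBasis H j)‖ ^ 2 := by
  have h := ρ.isTraceClass
  rw [IsTraceClass, traceNorm, CFC.abs_of_nonneg ρ.op ρ.nonneg] at h
  have h2 := ENNReal.summable_toReal h.ne
  refine h2.congr fun j => ?_
  rw [ρ.inner_op, ENNReal.toReal_ofReal (by positivity)]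

theorem hasSum_norm_inner_sq {ι : Type*} (b : HilbertBasis ι ℂ H) (x : H) :
    HasSum (fun i => ‖(inner ℂ (b i) x : ℂ)‖ ^ 2) (‖x‖ ^ 2) := by
  have h := (b.hasSum_inner_mul_inner x x).mapL Complex.reCLM
  have h2 : Complex.reCLM (inner ℂ x x : ℂ) = ‖x‖ ^ 2 := inner_self_eq_norm_sq (𝕜 := ℂ) x
  rw [h2] at h
  have h3 : (fun i => ‖(inner ℂ (b i) x : ℂ)‖ ^ 2)
      = fun i => Complex.reCLM ((inner ℂ x (b i) : ℂ) * inner ℂ (b i) x) := by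
    funext i
    rw [← inner_conj_symm x (b i), mul_comm, Complex.mul_conj, Complex.reCLM_apply,
      Complex.ofReal_re, Complex.normSq_eq_norm_sq]
  rw [h3]
  exact h

/-- `∑ᵢ ⟨eᵢ, ρ A eᵢ⟩ = ∑ⱼ ⟨√ρ fⱼ, A √ρ fⱼ⟩` for every Hilbert basis `(eᵢ)`, where `(fⱼ)` is the fixed
one; in particular `Tr ρ A` does not depend on the basis. -/
theorem DensityOperator.hasSum_mul (ρ : DensityOperator H) (A : H →L[ℂ] H) {ι : Type*}
    (e : HilbertBasis ι ℂ H) :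
    (Summable fun j => (inner ℂ (CFC.sqrt ρ.op (refBasis H j))
      (A (CFC.sqrt ρ.op (refBasis H j))) : ℂ)) ∧
    HasSum (fun i => (inner ℂ (e i) ((ρ.op * A) (e i)) : ℂ))
      (∑' j, inner ℂ (CFC.sqrt ρ.op (refBasis H j)) (A (CFC.sqrt ρ.op (refBasis H j)))) := by
  set S := CFC.sqrt ρ.op with hS
  set f := refBasis H with hf
  have hsum : Summable fun j => ‖S (f j)‖ ^ 2 := ρ.summable_sq
  let F : basisIndex H × ι → ℂ := fun p =>
    inner ℂ (A.adjoint (S (f p.1))) (e p.2) * inner ℂ (e p.2) (S (f p.1))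
  have hcol : ∀ j, HasSum (fun i => F (j, i)) (inner ℂ (S (f j)) (A (S (f j)))) := by
    intro j
    have h := e.hasSum_inner_mul_inner (A.adjoint (S (f j))) (S (f j))
    rwa [ContinuousLinearMap.adjoint_inner_left] at h
  have hrow : ∀ i, HasSum (fun j => F (j, i)) (inner ℂ (e i) ((ρ.op * A) (e i))) := by
    intro i
    have h := f.hasSum_inner_mul_inner (S (e i)) (S (A (e i)))
    have h1 : (inner ℂ (S (e i)) (S (A (e i))) : ℂ) = inner ℂ (e i) ((ρ.op * A) (e i)) := by
      rw [ρ.sqrt_symm, ρ.sqrt_sqrt]; rfl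
    rw [h1] at h
    refine h.congr_fun fun j => ?_
    show (inner ℂ (A.adjoint (S (f j))) (e i) : ℂ) * inner ℂ (e i) (S (f j)) = _
    rw [ContinuousLinearMap.adjoint_inner_left, ρ.sqrt_symm, ← ρ.sqrt_symm (e i), mul_comm]
  have hA : Summable fun j => ‖A.adjoint (S (f j))‖ ^ 2 := by
    refine Summable.of_nonneg_of_le (fun _ => by positivity) (fun j => ?_)
      (hsum.mul_left (‖A.adjoint‖ ^ 2))
    rw [← mul_pow]
    gcongr
    exact A.adjoint.le_opNorm _
  have hsq : ∀ g : basisIndex H → H, (Summable fun j => ‖g j‖ ^ 2) →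
      Summable fun p : basisIndex H × ι => ‖(inner ℂ (e p.2) (g p.1) : ℂ)‖ ^ 2 := by
    intro g hg
    refine (summable_prod_of_nonneg fun p => by positivity).2 ⟨fun j =>
      (hasSum_norm_inner_sq e (g j)).summable, ?_⟩
    refine hg.congr fun j => ?_
    exact (hasSum_norm_inner_sq e (g j)).tsum_eq.symm
  have hF : Summable F := by
    refine Summable.of_norm_bounded ((hsq _ hA).add (hsq _ hsum)) fun p => ?_
    show ‖(inner ℂ (A.adjoint (S (f p.1))) (e p.2) : ℂ) * inner ℂ (e p.2) (S (f p.1))‖ ≤ _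
    rw [norm_mul, norm_inner_symm]
    nlinarith [sq_nonneg (‖(inner ℂ (e p.2) (A.adjoint (S (f p.1))) : ℂ)‖
      - ‖(inner ℂ (e p.2) (S (f p.1)) : ℂ)‖),
      sq_nonneg (‖(inner ℂ (e p.2) (A.adjoint (S (f p.1))) : ℂ)‖),
      sq_nonneg (‖(inner ℂ (e p.2) (S (f p.1)) : ℂ)‖)]
  have h1 := hF.hasSum.prod_fiberwise hcol
  have h2 : HasSum (fun i => (inner ℂ (e i) ((ρ.op * A) (e i)) : ℂ)) (∑' p, F p) := by
    have h3 := ((Equiv.prodComm ι (basisIndex H)).hasSum_iff).2 hF.hasSum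
    exact h3.prod_fiberwise fun i => hrow i
  refine ⟨h1.summable, ?_⟩
  rw [h1.tsum_eq]
  exact h2

theorem DensityOperator.hasSum_povm (ρ : DensityOperator H) (M : POVM U H) {B : Set U}
    (hB : MeasurableSet B) :
    ENNReal.ofReal (trace (ρ.op * M.op B)).re = ∑' j, ENNReal.ofReal
      (inner ℂ (CFC.sqrt ρ.op (refBasis H j)) (M.op B (CFC.sqrt ρ.op (refBasis H j)))).re := by
  obtain ⟨h1, h2⟩ := ρ.hasSum_mul (M.op B) (refBasis H)
  have h3 := h1.hasSum.mapL Complex.reCLM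
  rw [trace, h2.tsum_eq, ← Complex.reCLM_apply, ← h3.tsum_eq]
  exact ENNReal.ofReal_tsum_of_nonneg
    (fun j => (M.isPositive B hB).re_inner_nonneg_right _) h3.summable

/-- The law `B ↦ Tr ρ M(B)` of the outcome of the measurement `M` in the state `ρ`. -/
def bornMeasure (ρ : DensityOperator H) (M : POVM U H) : Measure U :=
  Measure.ofMeasurable (fun B _ => ENNReal.ofReal (trace (ρ.op * M.op B)).re)
    (by
      have h0 : M.op ∅ = 0 := by
        have hx : ∀ x y : H, (inner ℂ x (M.op ∅ y) : ℂ) = 0 := fun x y => by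
          have h := M.hasSum_iUnion (fun _ => ∅) (fun _ => MeasurableSet.empty)
            (fun _ _ _ => disjoint_bot_left) x y
          exact summable_const_iff _ |>.1 h.summable
        ext y
        exact inner_self_eq_zero.1 (hx (M.op ∅ y) y)
      simp [h0, trace])
    (by
      intro B hB hd
      have hj : ∀ x : H, ENNReal.ofReal (inner ℂ x (M.op (⋃ i, B i) x)).re
          = ∑' i, ENNReal.ofReal (inner ℂ x (M.op (B i) x)).re := fun x => by
        have h := (M.hasSum_iUnion B hB hd x x).mapL Complex.reCLM
        rw [← Complex.reCLM_apply, ← h.tsum_eq]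
        exact ENNReal.ofReal_tsum_of_nonneg
          (fun i => (M.isPositive (B i) (hB i)).re_inner_nonneg_right _) h.summable
      rw [ρ.hasSum_povm M (MeasurableSet.iUnion hB)]
      simp_rw [hj, ρ.hasSum_povm M (hB _)]
      exact ENNReal.tsum_comm)

end Born

/-! ### Loss, risk and minimaxity -/

/-- The integral `∫ f⁺ dμ - ∫ f⁻ dμ` of an extended-real-valued function `f`
(meaningful when one of the two terms is finite, in particular when `f` is bounded from below
and `μ` is finite). -/
def extIntegral {α : Type*} [MeasurableSpace α] (μ : Measure α) (f : α → EReal) : EReal :=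
  ((∫⁻ x, (f x).toENNReal ∂μ : ℝ≥0∞) : EReal) - ((∫⁻ x, (-f x).toENNReal ∂μ : ℝ≥0∞) : EReal)

/-- A loss function: a lower semicontinuous function with values in `ℝ ∪ {+∞}`,
bounded from below. -/
structure IsLossFunction {Θ U : Type*} [TopologicalSpace Θ] [TopologicalSpace U]
    (w : Θ × U → EReal) : Prop where
  lowerSemicontinuous : LowerSemicontinuous w
  bddBelow : ∃ c : ℝ, ∀ p, (c : EReal) < w p

section Risk

variable {Θ U H : Type*} [MeasurableSpace U]
  [NormedAddCommGroup H] [InnerProductSpace ℂ H] [CompleteSpace H]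

/-- The risk `R_M(θ) = ∫ w(θ, u) Tr ρ(θ) M(du)`. -/
def risk (ρ : Θ → DensityOperator H) (w : Θ × U → EReal) (M : POVM U H) (θ : Θ) : EReal :=
  extIntegral (bornMeasure (ρ θ) M) fun u => w (θ, u)

/-- The worst-case risk `sup_θ R_M(θ)`. -/
def worstCaseRisk (ρ : Θ → DensityOperator H) (w : Θ × U → EReal) (M : POVM U H) : EReal :=
  ⨆ θ, risk ρ w M θ

/-- `M` minimizes the worst-case risk among all POVMs. -/
def IsMinimax (ρ : Θ → DensityOperator H) (w : Θ × U → EReal) (M : POVM U H) : Prop :=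
  ∀ M' : POVM U H, worstCaseRisk ρ w M ≤ worstCaseRisk ρ w M'

/-- The maximin value `V = sup_π inf_M ∫ R_M(θ) π(dθ)`, where `π` runs over the Borel
probability measures on `Θ` and `M` over the POVMs. -/
def maximinValue [MeasurableSpace Θ] (ρ : Θ → DensityOperator H) (w : Θ × U → EReal) : EReal :=
  ⨆ π : ProbabilityMeasure Θ, ⨅ M : POVM U H, extIntegral (π : Measure Θ) (risk ρ w M)

/-- The POVMs whose risk with respect to every continuous loss function `v ≤ w` is everywhere at
most the maximin value `V` of `w`. -/
def approxOptimalPOVMs [MeasurableSpace Θ] [TopologicalSpace Θ] [TopologicalSpace U]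
    (ρ : Θ → DensityOperator H) (w : Θ × U → EReal) : Set (POVM U H) :=
  {M | ∀ v : C(Θ × U, ℝ), (∀ p, (v p : EReal) ≤ w p) →
    ∀ θ, risk ρ (fun p => (v p : EReal)) M θ ≤ maximinValue ρ w}

end Risk

end

end QuantumDecision

/-!
# Existence of minimax measurements

The proof compares a POVM with finitely supported priors only, which are handled by separation of
convex sets in `ι → ℝ` for finite `ι`; the general case follows from the compactness of the set of
POVMs on a compact space. Injectivity and regularity of the family of states are not used.
-/

/-! Weak duality is immediate: the average of `risk ρ w M` over any prior is at most its supremum,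
so V bounds every worst-case risk from below (`maximinValue_le_worstCaseRisk`). If all continuous v
≤ w have risk at most V under M, then monotone convergence along continuous functions increasing to
w gives the same bound for w, and M is minimax.

For the existence of such an M, consider the conditions "the risk of v at θ is at most r", indexed
by triples (v, θ, r) with v ≤ w continuous and r > V. Finitely many of them can be met together.
Otherwise a hyperplane separates the convex set of attainable risk vectors from an open orthant; its
normalized coefficients form a finitely supported prior whose Bayes risk is at least some r > V for
every measurement, contradicting the definition of V (`exists_mem_forall_lt_of_convex`,
`exists_povm_forall_integral_lt`).

All conditions are met together by compactness (`exists_povm_tendsto_ultrafilter`). A POVM is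
encoded by its diagonal measures B ↦ ⟨x, M(B) x⟩, of mass ‖x‖², which have weak limits on the
compact space U; quadratic forms of operators survive these limits, so the limit measures again come
from a POVM. -/

namespace QuantumDecision

/-! ### Quadratic forms of bounded operators and their pointwise limits. -/

section OperatorForm

variable {H : Type*} [NormedAddCommGroup H] [InnerProductSpace ℂ H]

/-- `q` is the quadratic form `x ↦ ⟨x, T x⟩` of a bounded (necessarily self-adjoint) operator. -/
def IsOperatorForm (q : H → ℝ) : Prop :=
  ∃ T : H →L[ℂ] H, ∀ x, (inner ℂ x (T x) : ℂ) = q x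

/-- Polarization lets convergence and countable additivity be checked on the diagonal only. -/
theorem inner_right_polarization (T : H →L[ℂ] H) (x y : H) :
    (inner ℂ x (T y) : ℂ) =
      (inner ℂ (x + y) (T (x + y)) - inner ℂ (x - y) (T (x - y))
        - Complex.I * inner ℂ (x + Complex.I • y) (T (x + Complex.I • y))
        + Complex.I * inner ℂ (x - Complex.I • y) (T (x - Complex.I • y))) / 4 := by
  simp only [map_add, map_sub, inner_add_left, inner_add_right, inner_sub_left, inner_sub_right,
    map_smul, inner_smul_left, inner_smul_right, Complex.conj_I]
  ring_nf
  simp only [Complex.I_sq]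
  ring

theorem IsOperatorForm.add {q r : H → ℝ} (hq : IsOperatorForm q) (hr : IsOperatorForm r) :
    IsOperatorForm fun x => q x + r x := by
  obtain ⟨S, hS⟩ := hq
  obtain ⟨T, hT⟩ := hr
  exact ⟨S + T, fun x => by simp [hS, hT]⟩

theorem IsOperatorForm.const_mul {q : H → ℝ} (hq : IsOperatorForm q) (c : ℝ) :
    IsOperatorForm fun x => c * q x := by
  obtain ⟨T, hT⟩ := hq
  exact ⟨(c : ℂ) • T, fun x => by simp [hT]⟩

theorem isOperatorForm_norm_sq : IsOperatorForm fun x : H => ‖x‖ ^ 2 :=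
  ⟨1, fun x => by simp [inner_self_eq_norm_sq_to_K]⟩

theorem isOperatorForm_zero : IsOperatorForm fun _ : H => 0 := ⟨0, fun x => by simp⟩

theorem isOperatorForm_sum {ι : Type*} (s : Finset ι) {q : ι → H → ℝ}
    (hq : ∀ i ∈ s, IsOperatorForm (q i)) : IsOperatorForm fun x => ∑ i ∈ s, q i x := by
  classical
  induction s using Finset.induction_on with
  | empty => simpa using isOperatorForm_zero
  | insert a s ha ih =>
    simp_rw [Finset.sum_insert ha]
    exact (hq a (Finset.mem_insert_self a s)).add
      (ih fun i hi => hq i (Finset.mem_insert_of_mem hi))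

/-- A real-valued form makes `T` symmetric, so its norm is the supremum of the absolute Rayleigh
quotient. -/
theorem norm_le_of_abs_form_le {T : H →L[ℂ] H} {q : H → ℝ}
    (hT : ∀ x, (inner ℂ x (T x) : ℂ) = q x) {C : ℝ} (hC : 0 ≤ C) (hq : ∀ x, |q x| ≤ C * ‖x‖ ^ 2) :
    ‖T‖ ≤ C := by
  have hT' : ∀ x, (inner ℂ (T x) x : ℂ) = q x := fun x => by
    rw [← inner_conj_symm, hT, Complex.conj_ofReal]
  have hs : (T : H →ₗ[ℂ] H).IsSymmetric := by
    rw [LinearMap.isSymmetric_iff_inner_map_self_real]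
    intro x
    show (starRingEnd ℂ) (inner ℂ (T x) x : ℂ) = inner ℂ (T x) x
    rw [hT', Complex.conj_ofReal]
  rw [T.norm_eq_iSup_rayleighQuotient hs]
  refine Real.iSup_le (fun x => ?_) hC
  rw [ContinuousLinearMap.rayleighQuotient, ContinuousLinearMap.reApplyInnerSelf_apply, hT']
  simp only [RCLike.re_to_complex, Complex.ofReal_re]
  rw [abs_div, abs_of_nonneg (by positivity : 0 ≤ ‖x‖ ^ 2)]
  exact div_le_of_le_mul₀ (by positivity) hC (hq x)

variable [CompleteSpace H]

/-- By polarization all matrix entries converge; the uniform bound `C` makes the limit a bounded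
sesquilinear form, which the Riesz theorem represents by an operator. -/
theorem IsOperatorForm.of_tendsto {ι : Type*} {l : Filter ι} [l.NeBot] {q : ι → H → ℝ}
    (hq : ∀ i, IsOperatorForm (q i)) {C : ℝ} (hC : 0 ≤ C) (hb : ∀ i x, |q i x| ≤ C * ‖x‖ ^ 2)
    {r : H → ℝ} (hr : ∀ x, Tendsto (fun i => q i x) l (𝓝 (r x))) : IsOperatorForm r := by
  choose T hT using hq
  have hn : ∀ i, ‖T i‖ ≤ C := fun i => norm_le_of_abs_form_le (hT i) hC (hb i)
  have hr' : ∀ x, Tendsto (fun i => (inner ℂ x (T i x) : ℂ)) l (𝓝 (r x : ℂ)) := fun x => by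
    simp_rw [hT]
    exact (Complex.continuous_ofReal.tendsto _).comp (hr x)
  have hB : ∀ x y : H, ∃ b : ℂ, Tendsto (fun i => (inner ℂ x (T i y) : ℂ)) l (𝓝 b) := fun x y => by
    simp_rw [inner_right_polarization _ x y]
    exact ⟨_, ((((hr' _).sub (hr' _)).sub ((hr' _).const_mul _)).add
      ((hr' _).const_mul _)).div_const _⟩
  choose B hB using hB
  let F : H →ₗ⋆[ℂ] H →ₗ[ℂ] ℂ := LinearMap.mk₂'ₛₗ (starRingEnd ℂ) (RingHom.id ℂ) B
    (fun x y z => tendsto_nhds_unique (hB _ _) (by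
      simp_rw [inner_add_left]; exact (hB _ _).add (hB _ _)))
    (fun c x z => tendsto_nhds_unique (hB _ _) (by
      simp_rw [inner_smul_left]; exact (hB _ _).const_mul _))
    (fun x y z => tendsto_nhds_unique (hB _ _) (by
      simp_rw [map_add, inner_add_right]; exact (hB _ _).add (hB _ _)))
    (fun c x z => tendsto_nhds_unique (hB _ _) (by
      simp_rw [map_smul, inner_smul_right]; exact (hB _ _).const_mul _))
  have hF : ∀ x y, ‖F x y‖ ≤ C * ‖x‖ * ‖y‖ := fun x y =>
    le_of_tendsto (hB x y).norm (Eventually.of_forall fun i => by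
      calc ‖(inner ℂ x (T i y) : ℂ)‖ ≤ ‖x‖ * ‖T i y‖ := norm_inner_le_norm _ _
        _ ≤ ‖x‖ * (C * ‖y‖) := by
          gcongr
          exact (T i).le_of_opNorm_le (hn i) y
        _ = C * ‖x‖ * ‖y‖ := by ring)
  refine ⟨(InnerProductSpace.continuousLinearMapOfBilin (F.mkContinuous₂ C hF)).adjoint,
    fun x => ?_⟩
  rw [ContinuousLinearMap.adjoint_inner_right,
    InnerProductSpace.continuousLinearMapOfBilin_apply, LinearMap.mkContinuous₂_apply]
  exact tendsto_nhds_unique (hB x x) (hr' x)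

end OperatorForm

/-! ### Diagonal measures of a POVM and their relation to the Born measure. -/

section DiagonalMeasure

variable {H : Type*} [NormedAddCommGroup H] [InnerProductSpace ℂ H] [CompleteSpace H]
variable {U : Type*} [MeasurableSpace U]

theorem POVM.op_empty (M : POVM U H) : M.op ∅ = 0 := by
  have hx : ∀ x y : H, (inner ℂ x (M.op ∅ y) : ℂ) = 0 := fun x y =>
    summable_const_iff _ |>.1 (M.hasSum_iUnion (fun _ => ∅) (fun _ => MeasurableSet.empty)
      (fun _ _ _ => disjoint_bot_left) x y).summable
  ext y
  exact inner_self_eq_zero.1 (hx (M.op ∅ y) y)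

/-- The finite measure `B ↦ ⟨x, M(B) x⟩`. -/
noncomputable def POVM.diagMeasure (M : POVM U H) (x : H) : Measure U :=
  Measure.ofMeasurable (fun B _ => ENNReal.ofReal (inner ℂ x (M.op B x)).re)
    (by simp [M.op_empty])
    (by
      intro B hB hd
      have h := (M.hasSum_iUnion B hB hd x x).mapL Complex.reCLM
      rw [← Complex.reCLM_apply, ← h.tsum_eq]
      exact ENNReal.ofReal_tsum_of_nonneg
        (fun i => (M.isPositive (B i) (hB i)).re_inner_nonneg_right _) h.summable)

theorem POVM.diagMeasure_apply (M : POVM U H) (x : H) {B : Set U} (hB : MeasurableSet B) :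
    M.diagMeasure x B = ENNReal.ofReal (inner ℂ x (M.op B x)).re :=
  Measure.ofMeasurable_apply B hB

theorem POVM.diagMeasure_univ (M : POVM U H) (x : H) :
    M.diagMeasure x Set.univ = ENNReal.ofReal (‖x‖ ^ 2) := by
  rw [M.diagMeasure_apply x MeasurableSet.univ, M.op_univ]
  congr 1
  exact inner_self_eq_norm_sq (𝕜 := ℂ) x

instance (M : POVM U H) (x : H) : IsFiniteMeasure (M.diagMeasure x) :=
  ⟨by rw [M.diagMeasure_univ]; exact ENNReal.ofReal_lt_top⟩

/-- `POVM.diagMeasure` as an element of the space of finite measures. -/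
noncomputable def POVM.finiteDiagMeasure (M : POVM U H) (x : H) : FiniteMeasure U :=
  ⟨M.diagMeasure x, inferInstance⟩

theorem POVM.inner_op_self (M : POVM U H) (x : H) {B : Set U} (hB : MeasurableSet B) :
    (inner ℂ x (M.op B x) : ℂ) = (M.diagMeasure x).real B := by
  have h := M.isPositive B hB
  have h0 : 0 ≤ (inner ℂ x (M.op B x) : ℂ).re := h.re_inner_nonneg_right x
  rw [measureReal_def, M.diagMeasure_apply x hB, ENNReal.toReal_ofReal h0]
  refine (Complex.conj_eq_iff_re.1 ?_).symm
  rw [inner_conj_symm]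
  exact h.isSymmetric x x

theorem bornMeasure_apply (ρ : DensityOperator H) (M : POVM U H) {B : Set U}
    (hB : MeasurableSet B) :
    bornMeasure ρ M B = ENNReal.ofReal (trace (ρ.op * M.op B)).re :=
  Measure.ofMeasurable_apply B hB

/-- Tr ρM(B) = Tr √ρ M(B) √ρ, expanded in the reference basis. -/
theorem bornMeasure_eq_sum (ρ : DensityOperator H) (M : POVM U H) :
    bornMeasure ρ M
      = Measure.sum fun j => M.diagMeasure (CFC.sqrt ρ.op (refBasis H j)) := by
  ext B hB
  rw [bornMeasure_apply ρ M hB, Measure.sum_apply _ hB, ρ.hasSum_povm M hB]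
  simp_rw [M.diagMeasure_apply _ hB]

instance (ρ : DensityOperator H) (M : POVM U H) : IsProbabilityMeasure (bornMeasure ρ M) :=
  ⟨by rw [bornMeasure_apply ρ M MeasurableSet.univ, M.op_univ, mul_one, ρ.trace_eq_one]; simp⟩

theorem POVM.abs_integral_diagMeasure_le (M : POVM U H) {f : U → ℝ} {C : ℝ}
    (hf : ∀ u, |f u| ≤ C) (x : H) : |∫ u, f u ∂M.diagMeasure x| ≤ C * ‖x‖ ^ 2 := by
  have h := norm_integral_le_of_norm_le_const (μ := M.diagMeasure x) (f := f) (C := C)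
    (Eventually.of_forall hf)
  rwa [measureReal_def, M.diagMeasure_univ, ENNReal.toReal_ofReal (by positivity)] at h

theorem POVM.isOperatorForm_real (M : POVM U H) {B : Set U} (hB : MeasurableSet B) :
    IsOperatorForm fun x => (M.diagMeasure x).real B :=
  ⟨M.op B, fun x => M.inner_op_self x hB⟩

theorem POVM.isOperatorForm_integral (M : POVM U H) {f : U → ℝ} (hf : Measurable f) {C : ℝ}
    (hC : 0 ≤ C) (hb : ∀ u, |f u| ≤ C) : IsOperatorForm fun x => ∫ u, f u ∂M.diagMeasure x := by
  have hint : ∀ x, Integrable f (M.diagMeasure x) := fun x =>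
    Integrable.of_bound hf.aestronglyMeasurable C (Eventually.of_forall hb)
  -- The base point 0 gives |s n u| ≤ 2|f u|, hence the uniform bound `C + C` below.
  set s : ℕ → SimpleFunc U ℝ :=
    SimpleFunc.approxOn f hf (Set.range f ∪ {0}) 0 (by simp)
  have hsi : ∀ x n, Integrable (s n) (M.diagMeasure x) := fun x n =>
    SimpleFunc.integrable_approxOn_range hf (hint x) n
  have hsb : ∀ n u, |s n u| ≤ C + C := fun n u =>
    (SimpleFunc.norm_approxOn_zero_le hf (by simp) u n).trans (add_le_add (hb u) (hb u))
  refine IsOperatorForm.of_tendsto (l := atTop) (q := fun n x => ∫ u, s n u ∂M.diagMeasure x)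
    (fun n => ?_) (add_nonneg hC hC) (fun n x => M.abs_integral_diagMeasure_le (hsb n) x)
    (fun x => ?_)
  · simp_rw [← fun x => SimpleFunc.integral_eq_integral _ (hsi x n), SimpleFunc.integral_eq]
    refine isOperatorForm_sum _ fun c _ => ?_
    simp_rw [smul_eq_mul, mul_comm _ c]
    exact (M.isOperatorForm_real (SimpleFunc.measurableSet_fiber _ _)).const_mul c
  · have h := tendsto_integral_approxOn_of_measurable_of_range_subset hf (hint x) _ subset_rfl
    exact h.congr fun n => SimpleFunc.integral_eq_integral _ (hsi x n)

end DiagonalMeasure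

/-! ### Reconstruction of a POVM from its diagonal measures. -/

section Construction

theorem hasSum_measureReal_iUnion {α : Type*} [MeasurableSpace α] {μ : Measure α}
    [IsFiniteMeasure μ] {B : ℕ → Set α} (hd : Pairwise (Function.onFun Disjoint B))
    (hB : ∀ j, MeasurableSet (B j)) : HasSum (fun j => μ.real (B j)) (μ.real (⋃ j, B j)) := by
  have h := measure_iUnion (μ := μ) hd hB
  simp_rw [measureReal_def, h]
  have hne : ∑' j, μ (B j) ≠ ∞ := h ▸ measure_ne_top μ _
  rw [ENNReal.tsum_toReal_eq fun j => measure_ne_top μ _]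
  exact ENNReal.hasSum_toReal hne

variable {H : Type*} [NormedAddCommGroup H] [InnerProductSpace ℂ H] [CompleteSpace H]
variable {U : Type*} [MeasurableSpace U]

/-- Positivity and additivity are inherited from the measures, and the mass ‖x‖² forces M(U) = I,
since over ℂ the quadratic form determines the operator. -/
theorem exists_povm_of_isOperatorForm {μ : H → Measure U}
    (hμ : ∀ x, μ x Set.univ = ENNReal.ofReal (‖x‖ ^ 2))
    (hform : ∀ B, MeasurableSet B → IsOperatorForm fun x => (μ x).real B) :
    ∃ M : POVM U H, ∀ x, M.diagMeasure x = μ x := by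
  classical
  have hfin : ∀ x, IsFiniteMeasure (μ x) := fun x => ⟨by rw [hμ]; exact ENNReal.ofReal_lt_top⟩
  choose T hT using hform
  have hpos : ∀ B hB, (T B hB).IsPositive := fun B hB => by
    rw [ContinuousLinearMap.isPositive_iff_complex]
    intro x
    have h : (inner ℂ (T B hB x) x : ℂ) = (μ x).real B := by
      rw [← inner_conj_symm, hT B hB, Complex.conj_ofReal]
    rw [h]
    simp
  let M : POVM U H :=
    { op := fun B => if hB : MeasurableSet B then T B hB else 0
      isPositive := fun B hB => by rw [dif_pos hB]; exact hpos B hB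
      hasSum_iUnion := fun B hB hd x y => by
        have hdiag : ∀ x, HasSum (fun j => (inner ℂ x (T (B j) (hB j) x) : ℂ))
            (inner ℂ x (T (⋃ j, B j) (MeasurableSet.iUnion hB) x)) := fun x => by
          simp_rw [hT]
          exact Complex.hasSum_ofReal.2 (hasSum_measureReal_iUnion hd hB)
        simp_rw [dif_pos (hB _), dif_pos (MeasurableSet.iUnion hB), inner_right_polarization _ x y]
        exact ((((hdiag _).sub (hdiag _)).sub ((hdiag _).mul_left _)).add
          ((hdiag _).mul_left _)).div_const _
      op_univ := by
        rw [dif_pos MeasurableSet.univ]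
        refine ContinuousLinearMap.coe_injective ((ext_inner_map _ _).1 fun x => ?_)
        show (inner ℂ (T Set.univ MeasurableSet.univ x) x : ℂ) = inner ℂ x x
        rw [← inner_conj_symm, ← inner_conj_symm x x]
        congr 1
        show (inner ℂ x (T Set.univ MeasurableSet.univ x) : ℂ) = inner ℂ x x
        rw [hT]
        beta_reduce
        rw [measureReal_def, hμ, ENNReal.toReal_ofReal (by positivity),
          inner_self_eq_norm_sq_to_K]
        simp
      op_of_not_measurableSet := fun B hB => dif_neg hB }
  refine ⟨M, fun x => ?_⟩
  ext B hB
  rw [M.diagMeasure_apply x hB]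
  show ENNReal.ofReal (inner ℂ x ((if hB : MeasurableSet B then T B hB else 0) x)).re = _
  rw [dif_pos hB, hT, Complex.ofReal_re, ofReal_measureReal]

/-- The witness is the measurement that always reports the same point `u`. -/
theorem nonempty_povm [Nonempty U] : Nonempty (POVM U H) := by
  obtain ⟨u⟩ := ‹Nonempty U›
  obtain ⟨M, -⟩ := exists_povm_of_isOperatorForm (H := H)
    (μ := fun x => ENNReal.ofReal (‖x‖ ^ 2) • Measure.dirac u) (fun x => by simp) (fun B hB => by
      have h := (isOperatorForm_norm_sq (H := H)).const_mul ((Measure.dirac u).real B)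
      convert h using 2 with x
      rw [measureReal_ennreal_smul_apply, ENNReal.toReal_ofReal (by positivity), mul_comm])
  exact ⟨M⟩

theorem POVM.exists_convexCombination (M N : POVM U H) {a b : ℝ} (ha : 0 ≤ a) (hb : 0 ≤ b)
    (hab : a + b = 1) : ∃ P : POVM U H, ∀ x,
      P.diagMeasure x = ENNReal.ofReal a • M.diagMeasure x + ENNReal.ofReal b • N.diagMeasure x := by
  refine exists_povm_of_isOperatorForm (fun x => ?_) (fun B hB => ?_)
  · simp only [Measure.add_apply, Measure.smul_apply, diagMeasure_univ, smul_eq_mul]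
    rw [← add_mul, ← ENNReal.ofReal_add ha hb, hab, ENNReal.ofReal_one, one_mul]
  · have h := ((M.isOperatorForm_real hB).const_mul a).add ((N.isOperatorForm_real hB).const_mul b)
    convert h using 2 with x
    have : ∀ c : ℝ, ∀ μ : Measure U, IsFiniteMeasure μ → IsFiniteMeasure (ENNReal.ofReal c • μ) :=
      fun c μ _ => ⟨by simpa using ENNReal.mul_lt_top ENNReal.ofReal_lt_top (measure_lt_top μ _)⟩
    have h1 := this a (M.diagMeasure x) inferInstance
    have h2 := this b (N.diagMeasure x) inferInstance
    rw [measureReal_add_apply, measureReal_ennreal_smul_apply, measureReal_ennreal_smul_apply,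
      ENNReal.toReal_ofReal ha, ENNReal.toReal_ofReal hb]

end Construction

/-! ### Weak compactness of the set of POVMs. -/

section Compactness

variable {H : Type*} [NormedAddCommGroup H] [InnerProductSpace ℂ H] [CompleteSpace H]
variable {U : Type*} [MetricSpace U] [MeasurableSpace U] [BorelSpace U]

/-- A π-λ argument: for a closed set the thickened indicators decrease to its indicator, while
complements and disjoint unions are handled by linearity and bounded limits. -/
theorem isOperatorForm_real_of_integral {μ : H → Measure U}
    (hμ : ∀ x, μ x Set.univ = ENNReal.ofReal (‖x‖ ^ 2))
    (hform : ∀ f : BoundedContinuousFunction U ℝ, IsOperatorForm fun x => ∫ u, f u ∂μ x)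
    {B : Set U} (hB : MeasurableSet B) : IsOperatorForm fun x => (μ x).real B := by
  have hfin : ∀ x, IsFiniteMeasure (μ x) := fun x => ⟨by rw [hμ]; exact ENNReal.ofReal_lt_top⟩
  have hmass : ∀ x, (μ x).real Set.univ = ‖x‖ ^ 2 := fun x => by
    rw [measureReal_def, hμ, ENNReal.toReal_ofReal (by positivity)]
  have hle : ∀ x (B : Set U), (μ x).real B ≤ ‖x‖ ^ 2 := fun x B =>
    (measureReal_mono (Set.subset_univ B)).trans_eq (hmass x)
  induction B, hB using MeasurableSpace.induction_on_inter
    (borel_eq_generateFrom_isClosed (α := U) ▸ BorelSpace.measurable_eq) isPiSystem_isClosed with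
  | empty => simpa using isOperatorForm_zero
  | basic F hF =>
    have hpos : ∀ n : ℕ, (0 : ℝ) < 1 / ((n : ℝ) + 1) := fun n => Nat.one_div_pos_of_nat
    refine IsOperatorForm.of_tendsto (l := atTop)
      (q := fun (n : ℕ) x => ∫ u, (thickenedIndicator (hpos n) F u : ℝ) ∂μ x)
      (fun n => ?_) zero_le_one (fun n x => ?_) (fun x =>
        tendsto_integral_thickenedIndicator_of_isClosed (μ x) hF hpos
          tendsto_one_div_add_atTop_nhds_zero_nat)
    · exact hform (BoundedContinuousFunction.comp _ (LipschitzWith.subtype_val _)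
        (thickenedIndicator (hpos n) F))
    · have h := norm_integral_le_of_norm_le_const (μ := μ x) (C := 1)
        (f := fun u => (thickenedIndicator (hpos n) F u : ℝ)) (Eventually.of_forall fun u => by
          simpa using thickenedIndicator_le_one (hpos n) F u)
      rwa [hmass] at h
  | compl B hB ih =>
    have h := isOperatorForm_norm_sq.add (ih.const_mul (-1))
    convert h using 2 with x
    rw [measureReal_compl hB, hmass]
    ring
  | iUnion B hd hB ih =>
    refine IsOperatorForm.of_tendsto (l := atTop)
      (q := fun (s : Finset ℕ) x => ∑ j ∈ s, (μ x).real (B j))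
      (fun s => isOperatorForm_sum s fun j _ => ih j) zero_le_one (fun s x => ?_)
      (fun x => hasSum_measureReal_iUnion hd hB)
    rw [abs_of_nonneg (Finset.sum_nonneg fun _ _ => measureReal_nonneg), one_mul]
    have h := hasSum_measureReal_iUnion (μ := μ x) hd hB
    exact (sum_le_hasSum s (fun _ _ => measureReal_nonneg) h).trans (hle x _)

/-- The set of POVMs on a compact space is compact. -/
theorem exists_povm_tendsto_ultrafilter [CompactSpace U] {ι : Type*} (l : Ultrafilter ι)
    (M : ι → POVM U H) : ∃ N : POVM U H, ∀ x (f : BoundedContinuousFunction U ℝ),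
      Tendsto (fun i => ∫ u, f u ∂(M i).diagMeasure x) l (𝓝 (∫ u, f u ∂N.diagMeasure x)) := by
  have hex : ∀ x : H, ∃ ν : FiniteMeasure U, ν.mass = (‖x‖ ^ 2).toNNReal ∧
      Tendsto (fun i => (M i).finiteDiagMeasure x) l (𝓝 ν) := by
    intro x
    -- The mass does not depend on `i`, so the single ultrafilter `l` yields a weak limit for every
    -- `x` at once.
    have hK := isCompact_setOfPred_finiteMeasure_eq_of_compactSpace U (‖x‖ ^ 2).toNNReal
    obtain ⟨ν, hν, hlim⟩ := hK.ultrafilter_le_nhds'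
      (l.map fun i => (M i).finiteDiagMeasure x) (Filter.mem_map.2 (Eventually.of_forall fun i => by
        show (((M i).diagMeasure x) Set.univ).toNNReal = _
        rw [(M i).diagMeasure_univ]; rfl))
    exact ⟨ν, hν, hlim⟩
  choose ν hmass hlim using hex
  simp_rw [FiniteMeasure.tendsto_iff_forall_integral_tendsto] at hlim
  have huniv : ∀ x, (ν x : Measure U) Set.univ = ENNReal.ofReal (‖x‖ ^ 2) := fun x => by
    rw [← FiniteMeasure.ennreal_mass, hmass]; rfl
  obtain ⟨N, hN⟩ := exists_povm_of_isOperatorForm huniv fun B hB =>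
    isOperatorForm_real_of_integral huniv (fun f => IsOperatorForm.of_tendsto (l := (l : Filter ι))
      (fun i => (M i).isOperatorForm_integral f.continuous.measurable (norm_nonneg f)
        f.norm_coe_le_norm) (norm_nonneg f)
      (fun i x => (M i).abs_integral_diagMeasure_le f.norm_coe_le_norm x)
      (fun x => hlim x f)) hB
  exact ⟨N, fun x f => by rw [hN]; exact hlim x f⟩

end Compactness

/-! ### Mixtures and limits of POVMs under the Born measure. -/

section BornIntegral

variable {H : Type*} [NormedAddCommGroup H] [InnerProductSpace ℂ H] [CompleteSpace H]
variable {U : Type*} [MeasurableSpace U]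

theorem bornMeasure_convexCombination {M N P : POVM U H} {a b : ℝ≥0∞}
    (hP : ∀ x, P.diagMeasure x = a • M.diagMeasure x + b • N.diagMeasure x)
    (ρ : DensityOperator H) :
    bornMeasure ρ P = a • bornMeasure ρ M + b • bornMeasure ρ N := by
  ext B hB
  simp only [bornMeasure_eq_sum, Measure.add_apply, Measure.smul_apply, Measure.sum_apply _ hB, hP,
    smul_eq_mul, ENNReal.tsum_add, ENNReal.tsum_mul_left]

theorem integral_bornMeasure_convexCombination {M N P : POVM U H} {a b : ℝ} (ha : 0 ≤ a)
    (hb : 0 ≤ b) (hP : ∀ x, P.diagMeasure x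
      = ENNReal.ofReal a • M.diagMeasure x + ENNReal.ofReal b • N.diagMeasure x)
    (ρ : DensityOperator H) {f : U → ℝ} (hM : Integrable f (bornMeasure ρ M))
    (hN : Integrable f (bornMeasure ρ N)) :
    ∫ u, f u ∂bornMeasure ρ P = a * ∫ u, f u ∂bornMeasure ρ M + b * ∫ u, f u ∂bornMeasure ρ N := by
  rw [bornMeasure_convexCombination hP, integral_add_measure
    (hM.smul_measure ENNReal.ofReal_ne_top) (hN.smul_measure ENNReal.ofReal_ne_top),
    integral_smul_measure, integral_smul_measure, ENNReal.toReal_ofReal ha,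
    ENNReal.toReal_ofReal hb, smul_eq_mul, smul_eq_mul]

theorem integral_bornMeasure (ρ : DensityOperator H) (M : POVM U H) {f : U → ℝ}
    (hf : Integrable f (bornMeasure ρ M)) : ∫ u, f u ∂bornMeasure ρ M
      = ∑' j, ∫ u, f u ∂M.diagMeasure (CFC.sqrt ρ.op (refBasis H j)) := by
  rw [bornMeasure_eq_sum] at hf ⊢
  exact (hasSum_integral_measure hf).tsum_eq.symm

/-- Dominated convergence for series: the j-th term is at most ‖f‖ ‖√ρ fⱼ‖², which is summable
because ρ is of trace class. -/
theorem tendsto_integral_bornMeasure [TopologicalSpace U] [OpensMeasurableSpace U]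
    {ι : Type*} {l : Filter ι} {M : ι → POVM U H} {N : POVM U H}
    {f : BoundedContinuousFunction U ℝ}
    (h : ∀ x, Tendsto (fun i => ∫ u, f u ∂(M i).diagMeasure x) l
      (𝓝 (∫ u, f u ∂N.diagMeasure x))) (ρ : DensityOperator H) :
    Tendsto (fun i => ∫ u, f u ∂bornMeasure ρ (M i)) l (𝓝 (∫ u, f u ∂bornMeasure ρ N)) := by
  simp_rw [integral_bornMeasure ρ _ (f.integrable _)]
  exact tendsto_tsum_of_dominated_convergence (ρ.summable_sq.mul_left ‖f‖) (fun j => h _)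
    (Eventually.of_forall fun i j => (M i).abs_integral_diagMeasure_le f.norm_coe_le_norm _)

end BornIntegral

/-! ### The extended integral: monotone limits and finitely supported priors. -/

section ExtIntegral

variable {α : Type*} [MeasurableSpace α]

theorem extIntegral_mono (μ : Measure α) {f g : α → EReal} (h : ∀ x, f x ≤ g x) :
    extIntegral μ f ≤ extIntegral μ g :=
  EReal.sub_le_sub
    (EReal.coe_ennreal_le_coe_ennreal_iff.2
      (lintegral_mono fun x => EReal.toENNReal_le_toENNReal (h x)))
    (EReal.coe_ennreal_le_coe_ennreal_iff.2
      (lintegral_mono fun x => EReal.toENNReal_le_toENNReal (EReal.neg_le_neg_iff.2 (h x))))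

theorem extIntegral_const (μ : Measure α) [IsProbabilityMeasure μ] (c : EReal) :
    extIntegral μ (fun _ => c) = c := by
  simp only [extIntegral, lintegral_const, measure_univ, mul_one, EReal.coe_toENNReal_eq_max]
  rcases le_total 0 c with h | h
  · rw [max_eq_right h, max_eq_left (EReal.neg_le_zero.2 h), sub_zero]
  · rw [max_eq_left h, max_eq_right (EReal.neg_nonneg.2 h), zero_sub, neg_neg]

theorem extIntegral_coe {μ : Measure α} {f : α → ℝ} (hf : Integrable f μ) :
    extIntegral μ (fun x => (f x : EReal)) = ((∫ x, f x ∂μ : ℝ) : EReal) := by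
  have hneg : ∫⁻ x, ENNReal.ofReal (-f x) ∂μ ≠ ∞ := hf.neg.lintegral_lt_top.ne
  rw [integral_eq_lintegral_pos_part_sub_lintegral_neg_part hf, EReal.coe_sub,
    EReal.coe_ennreal_toReal hf.lintegral_lt_top.ne, EReal.coe_ennreal_toReal hneg]
  rfl

/-- Positive parts converge monotonically; negative parts are dominated by the constant (-c)⁺,
integrable as `μ` is finite. -/
theorem tendsto_extIntegral_of_monotone {μ : Measure α} [IsFiniteMeasure μ] {f : ℕ → α → ℝ}
    {g : α → EReal} {c : ℝ} (hmeas : ∀ n, Measurable (f n)) (hmono : ∀ x, Monotone fun n => f n x)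
    (hc : ∀ n x, c ≤ f n x) (hlim : ∀ x, Tendsto (fun n => (f n x : EReal)) atTop (𝓝 (g x))) :
    Tendsto (fun n => extIntegral μ fun x => (f n x : EReal)) atTop (𝓝 (extIntegral μ g)) := by
  have hcg : ∀ x, (c : EReal) ≤ g x := fun x =>
    ge_of_tendsto' (hlim x) fun n => EReal.coe_le_coe_iff.2 (hc n x)
  have hpos : Tendsto (fun n => ∫⁻ x, (f n x : EReal).toENNReal ∂μ) atTop
      (𝓝 (∫⁻ x, (g x).toENNReal ∂μ)) :=
    lintegral_tendsto_of_tendsto_of_monotone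
      (fun n => (hmeas n).coe_real_ereal.ereal_toENNReal.aemeasurable)
      (Eventually.of_forall fun x m n hmn =>
        EReal.toENNReal_le_toENNReal (EReal.coe_le_coe_iff.2 (hmono x hmn)))
      (Eventually.of_forall fun x => (EReal.continuous_toENNReal.tendsto _).comp (hlim x))
  have hneg : Tendsto (fun n => ∫⁻ x, (-(f n x : EReal)).toENNReal ∂μ) atTop
      (𝓝 (∫⁻ x, (-g x).toENNReal ∂μ)) := by
    refine tendsto_lintegral_of_dominated_convergence (fun _ => (-(c : EReal)).toENNReal)
      (fun n => ((hmeas n).neg.coe_real_ereal).ereal_toENNReal)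
      (fun n => Eventually.of_forall fun x => EReal.toENNReal_le_toENNReal
        (EReal.neg_le_neg_iff.2 (EReal.coe_le_coe_iff.2 (hc n x)))) ?_
      (Eventually.of_forall fun x =>
        (EReal.continuous_toENNReal.tendsto _).comp ((continuous_neg.tendsto _).comp (hlim x)))
    rw [lintegral_const]
    exact ENNReal.mul_ne_top (EReal.toENNReal_ne_top_iff.2 (by simp)) (measure_ne_top μ _)
  have hfin : ∫⁻ x, (-g x).toENNReal ∂μ ≠ ∞ := by
    refine ((lintegral_mono fun x => EReal.toENNReal_le_toENNReal
      (EReal.neg_le_neg_iff.2 (hcg x))).trans_lt ?_).ne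
    rw [lintegral_const]
    exact ENNReal.mul_lt_top (EReal.toENNReal_ne_top_iff.2 (by simp)).lt_top (measure_lt_top μ _)
  -- Finiteness of the negative part excludes ∞ - ∞, where addition is not continuous.
  have hadd := EReal.continuousAt_add (p := (((∫⁻ x, (g x).toENNReal ∂μ : ℝ≥0∞) : EReal),
    -((∫⁻ x, (-g x).toENNReal ∂μ : ℝ≥0∞) : EReal)))
    (Or.inr (by simpa using hfin)) (Or.inl (by simp))
  exact hadd.tendsto.comp ((EReal.tendsto_coe_ennreal.2 hpos).prodMk_nhds
    ((continuous_neg.tendsto _).comp (EReal.tendsto_coe_ennreal.2 hneg)))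

/-- The mixture `∑ᵢ cᵢ δ_{xᵢ}` of Dirac measures. -/
noncomputable def diracMixture {ι : Type*} [Fintype ι] (c : ι → ℝ) (x : ι → α) : Measure α :=
  ∑ i, ENNReal.ofReal (c i) • Measure.dirac (x i)

theorem isProbabilityMeasure_diracMixture {ι : Type*} [Fintype ι] {c : ι → ℝ}
    (hc : c ∈ stdSimplex ℝ ι) (x : ι → α) : IsProbabilityMeasure (diracMixture c x) :=
  ⟨by
    simp only [diracMixture, Measure.coe_finsetSum, Finset.sum_apply, Measure.smul_apply,
      measure_univ, smul_eq_mul, mul_one]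
    rw [← ENNReal.ofReal_sum_of_nonneg fun i _ => hc.1 i, hc.2, ENNReal.ofReal_one]⟩

/-- With measurable singletons `f` may be arbitrary, so measurability of the risk in θ never has to
be shown. -/
theorem lintegral_diracMixture [MeasurableSingletonClass α] {ι : Type*} [Fintype ι] (c : ι → ℝ)
    (x : ι → α) (f : α → ℝ≥0∞) :
    ∫⁻ y, f y ∂diracMixture c x = ∑ i, ENNReal.ofReal (c i) * f (x i) := by
  simp [diracMixture]

/-- Values of `f` may be infinite, and a point may occur several times with different lower bounds
`r i`. -/
theorem sum_mul_le_extIntegral_diracMixture [MeasurableSingletonClass α] {ι : Type*} [Fintype ι]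
    {c : ι → ℝ} (hc : ∀ i, 0 ≤ c i) {x : ι → α} {f : α → EReal} {r : ι → ℝ}
    (h : ∀ i, (r i : EReal) ≤ f (x i)) :
    ((∑ i, c i * r i : ℝ) : EReal) ≤ extIntegral (diracMixture c x) f := by
  have hsum : ∀ s : ι → ℝ, ∑ i, ENNReal.ofReal (c i) * (s i : EReal).toENNReal
      = ENNReal.ofReal (∑ i, c i * max (s i) 0) := fun s => by
    rw [ENNReal.ofReal_sum_of_nonneg fun i _ => mul_nonneg (hc i) (le_max_right _ _)]
    refine Finset.sum_congr rfl fun i _ => ?_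
    rw [EReal.real_coe_toENNReal, ENNReal.ofReal_mul (hc i), ENNReal.ofReal_max]
    simp
  have hnn : ∀ s : ι → ℝ, 0 ≤ ∑ i, c i * max (s i) 0 := fun s =>
    Finset.sum_nonneg fun i _ => mul_nonneg (hc i) (le_max_right _ _)
  have hr : ∑ i, c i * r i = (∑ i, c i * max (r i) 0) - ∑ i, c i * max (-r i) 0 := by
    rw [← Finset.sum_sub_distrib]
    refine Finset.sum_congr rfl fun i _ => ?_
    rw [← mul_sub]
    congr 1
    rcases le_total 0 (r i) with h | h
    · rw [max_eq_left h, max_eq_right (by linarith), sub_zero]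
    · rw [max_eq_right h, max_eq_left (by linarith)]; ring
  rw [extIntegral, lintegral_diracMixture, lintegral_diracMixture, hr, EReal.coe_sub]
  refine EReal.sub_le_sub ?_ ?_
  · calc ((∑ i, c i * max (r i) 0 : ℝ) : EReal)
        = (ENNReal.ofReal (∑ i, c i * max (r i) 0) : EReal) := by
          rw [EReal.coe_ennreal_ofReal, max_eq_left (hnn r)]
      _ ≤ _ := by
          rw [← hsum, EReal.coe_ennreal_le_coe_ennreal_iff]
          gcongr with i
          exact EReal.toENNReal_le_toENNReal (h i)
  · calc _ ≤ (ENNReal.ofReal (∑ i, c i * max (-r i) 0) : EReal) := by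
          rw [← hsum fun i => -r i, EReal.coe_ennreal_le_coe_ennreal_iff]
          gcongr with i
          exact EReal.toENNReal_le_toENNReal (by simpa using h i)
      _ = ((∑ i, c i * max (-r i) 0 : ℝ) : EReal) := by
          rw [EReal.coe_ennreal_ofReal, max_eq_left (hnn fun i => -r i)]

end ExtIntegral

/-! ### Approximation of lower semicontinuous functions from below. -/

section Semicontinuous

/-- A lower semicontinuous function that is bounded from below on a metric space is the limit of an
increasing sequence of continuous functions. -/
theorem exists_continuous_tendsto_of_lowerSemicontinuous {X : Type*} [MetricSpace X]
    {w : X → EReal} (hw : LowerSemicontinuous w) {c : ℝ} (hc : ∀ p, (c : EReal) < w p) :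
    ∃ v : ℕ → C(X, ℝ), (∀ p, Monotone fun n => v n p) ∧ (∀ n p, c ≤ v n p) ∧
      (∀ n p, (v n p : EReal) ≤ w p) ∧
      ∀ p, Tendsto (fun n => (v n p : EReal)) atTop (𝓝 (w p)) := by
  have hex : ∀ (n : ℕ) q, ∃ g : ℝ, (g : EReal) = min (w q) ((c + n : ℝ) : EReal) := fun n q =>
    ⟨_, EReal.coe_toReal ((min_le_right _ _).trans_lt (EReal.coe_lt_top _)).ne
      ((lt_min ((EReal.bot_lt_coe c).trans (hc q)) (EReal.bot_lt_coe _)).ne')⟩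
  choose g hg using hex
  have hgc : ∀ n q, c ≤ g n q := fun n q => by
    rw [← EReal.coe_le_coe_iff, hg]
    exact le_min (hc q).le (EReal.coe_le_coe_iff.2 (by simp))
  have hgw : ∀ n q, (g n q : EReal) ≤ w q := fun n q => (hg n q).trans_le (min_le_left _ _)
  have hgmono : ∀ q, Monotone fun n => g n q := fun q m n hmn => by
    show g m q ≤ g n q
    rw [← EReal.coe_le_coe_iff, hg, hg]
    exact min_le_min le_rfl (EReal.coe_le_coe_iff.2 (by gcongr))
  have hlow : ∀ (n : ℕ) p q, c ≤ g n q + n * dist p q := fun n p q =>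
    (hgc n q).trans (le_add_of_nonneg_right (by positivity))
  have hbdd : ∀ (n : ℕ) p, BddBelow (Set.range fun q => g n q + n * dist p q) := fun n p =>
    ⟨c, by rintro _ ⟨q, rfl⟩; exact hlow n p q⟩
  -- Lipschitz regularization of the truncation min(w, c + n), with constant n.
  let v : ℕ → X → ℝ := fun n p => ⨅ q, (g n q + n * dist p q)
  have hvle : ∀ n p, v n p ≤ g n p := fun n p =>
    (ciInf_le (hbdd n p) p).trans_eq (by simp)
  have hcont : ∀ n, Continuous (v n) := fun n => by
    refine (LipschitzWith.of_le_add_mul n fun p p' => ?_).continuous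
    have : Nonempty X := ⟨p⟩
    rw [← sub_le_iff_le_add]
    refine le_ciInf fun q => ?_
    rw [sub_le_iff_le_add]
    refine (ciInf_le (hbdd n p) q).trans ?_
    have h := mul_le_mul_of_nonneg_left (dist_triangle p p' q) (Nat.cast_nonneg (α := ℝ) n)
    rw [NNReal.coe_natCast]
    linarith
  refine ⟨fun n => ⟨v n, hcont n⟩, fun p m n hmn => ?_, fun n p => ?_, fun n p => ?_, fun p => ?_⟩
  · have : Nonempty X := ⟨p⟩
    refine ciInf_mono (hbdd m p) fun q => ?_
    have := hgmono q hmn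
    gcongr
  · have : Nonempty X := ⟨p⟩
    exact le_ciInf fun q => hlow n p q
  · exact (EReal.coe_le_coe_iff.2 (hvle n p)).trans (hgw n p)
  · refine tendsto_order.2 ⟨fun a ha => ?_, fun a ha => Eventually.of_forall fun n =>
      ((EReal.coe_le_coe_iff.2 (hvle n p)).trans (hgw n p)).trans_lt ha⟩
    obtain ⟨y, hay, hyw⟩ := EReal.lt_iff_exists_real_btwn.1 ha
    obtain ⟨r, hr, hball⟩ := Metric.eventually_nhds_iff.1 (hw p y hyw)
    -- The first condition puts the truncation level above `y`, for q near p; the second makes the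
    -- penalty n·r at least y - c, for q far from p.
    filter_upwards [tendsto_natCast_atTop_atTop.eventually_ge_atTop (y - c),
      (tendsto_natCast_atTop_atTop.atTop_mul_const hr).eventually_ge_atTop (y - c)] with n h1 h2
    refine hay.trans_le (EReal.coe_le_coe_iff.2 ?_)
    have : Nonempty X := ⟨p⟩
    refine le_ciInf fun q => ?_
    by_cases hq : dist q p < r
    · have hy : y ≤ g n q := by
        rw [← EReal.coe_le_coe_iff, hg]
        exact le_min (hball hq).le (EReal.coe_le_coe_iff.2 (by linarith))
      exact hy.trans (le_add_of_nonneg_right (by positivity))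
    · rw [dist_comm, not_lt] at hq
      have h3 := mul_le_mul_of_nonneg_left hq (Nat.cast_nonneg (α := ℝ) n)
      linarith [hgc n q]

end Semicontinuous

/-! ### A finite-dimensional minimax lemma. -/

section Separation

/-- Otherwise a functional separates `A` from the open orthant {b < r}. The orthant is unbounded
downwards, so the coefficients are nonnegative; normalized, they are weights `c` contradicting `h`.
-/
theorem exists_mem_forall_lt_of_convex {ι : Type*} [Fintype ι] {A : Set (ι → ℝ)}
    (hA : Convex ℝ A) (hne : A.Nonempty) {r : ℝ}
    (h : ∀ c ∈ stdSimplex ℝ ι, ∃ a ∈ A, ∑ i, c i * a i < r) : ∃ a ∈ A, ∀ i, a i < r := by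
  classical
  by_contra hcon
  let B : Set (ι → ℝ) := Set.univ.pi fun _ => Set.Iio r
  have hB : ∀ b : ι → ℝ, b ∈ B ↔ ∀ i, b i < r := fun b => by simp [B]
  have hdisj : Disjoint B A := Set.disjoint_left.2 fun a haB haA => hcon ⟨a, haA, (hB a).1 haB⟩
  obtain ⟨f, u, hfB, hfA⟩ := geometric_hahn_banach_open
    (convex_pi fun _ _ => convex_Iio r) (isOpen_set_pi Set.finite_univ fun _ _ => isOpen_Iio)
    hA hdisj
  obtain ⟨a₀, ha₀⟩ := hne
  let m : ι → ℝ := fun i => f (Pi.single i 1)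
  have hf : ∀ x : ι → ℝ, f x = ∑ i, m i * x i := fun x => by
    rw [← ContinuousLinearMap.coe_coe, LinearMap.pi_apply_eq_sum_univ]
    refine Finset.sum_congr rfl fun i _ => ?_
    rw [smul_eq_mul, mul_comm]
    refine congrArg (· * x i) (congrArg f (funext fun j => ?_))
    simp [Pi.single_apply, eq_comm]
  have hconst : ∀ y < r, (∑ i, m i) * y < u := fun y hy => by
    have h1 := hfB (fun _ => y) ((hB _).2 fun _ => hy)
    rwa [hf, ← Finset.sum_mul] at h1
  have hm : ∀ i, 0 ≤ m i := fun i => by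
    by_contra! hi
    set b : ι → ℝ := fun _ => r - 1
    have hb : f b < u := hfB b ((hB _).2 fun _ => by simp [b])
    -- Chosen so that f(b - t eᵢ) = u exactly, although this point still lies in the orthant.
    set t := (u - f b) / (-m i)
    have ht : 0 ≤ t := div_nonneg (by linarith) (by linarith)
    have h1 := hfB (b - t • Pi.single i 1) ((hB _).2 fun j => by
      have : 0 ≤ t * (Pi.single i (1 : ℝ) : ι → ℝ) j :=
        mul_nonneg ht (by rw [Pi.single_apply]; split_ifs <;> norm_num)
      simp only [b, Pi.sub_apply, Pi.smul_apply, smul_eq_mul]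
      linarith)
    rw [map_sub, map_smul, smul_eq_mul] at h1
    have h2 : t * m i = -(u - f b) := by
      have : m i ≠ 0 := hi.ne
      simp only [t]
      field_simp
    change f b - t * m i < u at h1
    linarith
  have hS : 0 < ∑ i, m i := by
    refine (Finset.sum_nonneg fun i _ => hm i).lt_of_ne fun h0 => ?_
    have hm0 : ∀ i, m i = 0 := fun i =>
      (Finset.sum_eq_zero_iff_of_nonneg fun i _ => hm i).1 h0.symm i (Finset.mem_univ i)
    have h1 := hconst (r - 1) (by linarith)
    have h2 := hfA a₀ ha₀
    rw [← h0, zero_mul] at h1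
    rw [hf] at h2
    simp only [hm0, zero_mul, Finset.sum_const_zero] at h2
    linarith
  obtain ⟨a, ha, har⟩ := h (fun i => m i / ∑ i, m i)
    ⟨fun i => div_nonneg (hm i) hS.le, by rw [← Finset.sum_div, div_self hS.ne']⟩
  have h1 : ∑ i, (m i / ∑ i, m i) * a i = f a / ∑ i, m i := by
    rw [hf, Finset.sum_div]
    exact Finset.sum_congr rfl fun i _ => by ring
  rw [h1] at har
  -- Applied to the constant vector f a / ∑ m, on which `f` takes the value f a; hence f a < u.
  have h2 := hconst _ har
  rw [mul_div_cancel₀ _ hS.ne'] at h2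
  exact (hfA a ha).not_gt h2

end Separation

/-! ### Weak duality, the finite game, and passage to the limit. -/

section Minimax

variable {Θ U H : Type*} [MeasurableSpace U]
  [NormedAddCommGroup H] [InnerProductSpace ℂ H] [CompleteSpace H]

theorem maximinValue_le_worstCaseRisk [MeasurableSpace Θ] (ρ : Θ → DensityOperator H) (w : Θ × U → EReal)
    (M : POVM U H) : maximinValue ρ w ≤ worstCaseRisk ρ w M :=
  iSup_le fun π => (iInf_le _ M).trans <|
    (extIntegral_mono _ fun θ => le_iSup (risk ρ w M) θ).trans_eq
      (extIntegral_const (π : Measure Θ) _)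

variable [MetricSpace U] [BorelSpace U]

theorem convex_range_integral_bornMeasure {ι : Type*} (ρ : ι → DensityOperator H)
    (f : ι → BoundedContinuousFunction U ℝ) :
    Convex ℝ (Set.range fun (M : POVM U H) i => ∫ u, f i u ∂bornMeasure (ρ i) M) := by
  rintro _ ⟨M, rfl⟩ _ ⟨N, rfl⟩ a b ha hb hab
  obtain ⟨P, hP⟩ := M.exists_convexCombination N ha hb hab
  refine ⟨P, funext fun i => ?_⟩
  exact integral_bornMeasure_convexCombination ha hb hP (ρ i) ((f i).integrable _)
    ((f i).integrable _)

variable [CompactSpace U] [MetricSpace Θ]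

/-- The section `v(θ, ·)` of a continuous function as a bounded continuous function. -/
def lossSection (v : C(Θ × U, ℝ)) (θ : Θ) : BoundedContinuousFunction U ℝ :=
  BoundedContinuousFunction.mkOfCompact (v.comp (.prodMk (.const U θ) (.id U)))

theorem risk_coe (ρ : Θ → DensityOperator H) (v : C(Θ × U, ℝ)) (M : POVM U H) (θ : Θ) :
    risk ρ (fun p => (v p : EReal)) M θ
      = ((∫ u, lossSection v θ u ∂bornMeasure (ρ θ) M : ℝ) : EReal) :=
  extIntegral_coe ((lossSection v θ).integrable _)

variable [MeasurableSpace Θ]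

theorem isMinimax_of_mem_approxOptimalPOVMs (ρ : Θ → DensityOperator H) {w : Θ × U → EReal}
    (hw : IsLossFunction w) {M : POVM U H} (hM : M ∈ approxOptimalPOVMs ρ w) :
    IsMinimax ρ w M := by
  obtain ⟨c, hc⟩ := hw.bddBelow
  obtain ⟨v, hmono, hcv, hvw, hlim⟩ :=
    exists_continuous_tendsto_of_lowerSemicontinuous hw.lowerSemicontinuous hc
  refine fun M' => (iSup_le fun θ => ?_).trans (maximinValue_le_worstCaseRisk ρ w M')
  exact le_of_tendsto' (tendsto_extIntegral_of_monotone
    (fun n => ((v n).continuous.comp (.prodMk_right θ)).measurable)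
    (fun u => hmono (θ, u)) (fun n u => hcv n (θ, u)) fun u => hlim (θ, u))
    fun n => hM (v n) (hvw n) θ

/-- For weights `c`, the prior ∑ cᵢ δ_{θᵢ} has infimal Bayes risk at most V < r, so some POVM beats
r on average; since vᵢ ≤ w, so do the averaged risks of the vᵢ. -/
theorem exists_povm_forall_integral_lt [MeasurableSingletonClass Θ] [Nonempty U]
    (ρ : Θ → DensityOperator H) (w : Θ × U → EReal) {ι : Type*} [Fintype ι]
    {v : ι → C(Θ × U, ℝ)} (hv : ∀ i p, (v i p : EReal) ≤ w p) (θ : ι → Θ) {r : ℝ}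
    (hr : maximinValue ρ w < r) :
    ∃ M : POVM U H, ∀ i, ∫ u, lossSection (v i) (θ i) u ∂bornMeasure (ρ (θ i)) M < r := by
  have hne : Nonempty (POVM U H) := nonempty_povm
  obtain ⟨_, ⟨M, rfl⟩, hM⟩ := exists_mem_forall_lt_of_convex (r := r)
    (convex_range_integral_bornMeasure (fun i => ρ (θ i)) fun i => lossSection (v i) (θ i))
    (Set.range_nonempty _) fun c hc => by
      have hprior : (⨅ M : POVM U H, extIntegral (diracMixture c θ) (risk ρ w M)) < r :=
        (le_iSup (fun π : ProbabilityMeasure Θ => ⨅ M : POVM U H, extIntegral (π : Measure Θ)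
          (risk ρ w M)) ⟨_, isProbabilityMeasure_diracMixture hc θ⟩).trans_lt hr
      obtain ⟨M, hM⟩ := iInf_lt_iff.1 hprior
      refine ⟨_, ⟨M, rfl⟩, EReal.coe_lt_coe_iff.1 (lt_of_le_of_lt ?_ hM)⟩
      refine sum_mul_le_extIntegral_diracMixture hc.1 fun i => ?_
      rw [← risk_coe]
      exact extIntegral_mono _ fun u => hv i _
  exact ⟨M, hM⟩

theorem approxOptimalPOVMs_nonempty [MeasurableSingletonClass Θ] [Nonempty U]
    (ρ : Θ → DensityOperator H) (w : Θ × U → EReal) :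
    (approxOptimalPOVMs ρ w : Set (POVM U H)).Nonempty := by
  classical
  -- Levels r strictly above V supply the slack needed for separation; r ↓ V is taken only at the
  -- end, and V = ⊤ leaves no conditions.
  let I := {i : C(Θ × U, ℝ) × Θ × ℝ //
    (∀ p, (i.1 p : EReal) ≤ w p) ∧ maximinValue ρ w < (i.2.2 : EReal)}
  have hfin : ∀ F : Finset I, ∃ M : POVM U H, ∀ i ∈ F,
      ∫ u, lossSection i.1.1 i.1.2.1 u ∂bornMeasure (ρ i.1.2.1) M ≤ i.1.2.2 := by
    intro F
    rcases F.eq_empty_or_nonempty with rfl | hF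
    · obtain ⟨M⟩ : Nonempty (POVM U H) := nonempty_povm
      exact ⟨M, by simp⟩
    -- The finite game has one common level, so the smallest one in `F` is used.
    obtain ⟨k, hk, hmin⟩ := F.exists_min_image (fun i => i.1.2.2) hF
    obtain ⟨M, hM⟩ := exists_povm_forall_integral_lt ρ w (ι := F) (v := fun i => i.1.1.1)
      (fun i => i.1.2.1) (fun i => i.1.1.2.1) k.2.2
    exact ⟨M, fun i hi => (hM ⟨i, hi⟩).le.trans (hmin i hi)⟩
  choose M hM using hfin
  -- Each condition holds for all finite sets containing it, hence along this ultrafilter, and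
  -- passes to the limit.
  obtain ⟨N, hN⟩ := exists_povm_tendsto_ultrafilter (Ultrafilter.of (atTop : Filter (Finset I))) M
  refine ⟨N, fun v hv θ => EReal.le_of_forall_lt_iff_le.1 fun r hr => ?_⟩
  rw [risk_coe, EReal.coe_le_coe_iff]
  refine le_of_tendsto (tendsto_integral_bornMeasure (fun x => hN x (lossSection v θ)) (ρ θ))
    (Ultrafilter.of_le _ ?_)
  let i : I := ⟨(v, θ, r), hv, hr⟩
  filter_upwards [eventually_ge_atTop ({i} : Finset I)] with F hF
  exact hM F i (Finset.singleton_subset_iff.1 hF)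

end Minimax

end QuantumDecision

theorem mainTheorem6
    {Θ : Type*} [MetricSpace Θ] [CompactSpace Θ] [MeasurableSpace Θ] [BorelSpace Θ]
    {U : Type*} [MetricSpace U] [CompactSpace U] [Nonempty U] [MeasurableSpace U] [BorelSpace U]
    {H : Type*} [NormedAddCommGroup H] [InnerProductSpace ℂ H] [CompleteSpace H]
    (ρ : Θ → QuantumDecision.DensityOperator H)
    (hinj : Function.Injective ρ)
    (hreg : QuantumDecision.IsRegular fun θ => (ρ θ).op)
    (w : Θ × U → EReal) (hw : QuantumDecision.IsLossFunction w) :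
    (∃ M ∈ QuantumDecision.approxOptimalPOVMs ρ w, QuantumDecision.IsMinimax ρ w M) ∧
      ∀ M ∈ QuantumDecision.approxOptimalPOVMs ρ w, QuantumDecision.IsMinimax ρ w M := by
  obtain ⟨M, hM⟩ := QuantumDecision.approxOptimalPOVMs_nonempty ρ w
  exact ⟨⟨M, hM, QuantumDecision.isMinimax_of_mem_approxOptimalPOVMs ρ hw hM⟩,
    fun _ hN => QuantumDecision.isMinimax_of_mem_approxOptimalPOVMs ρ hw hN⟩
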